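/- **Setting.** Two noncolluding replicated servers store $\mathsf M=2$ independent files $X^{(1)},X^{(2)}$, each uniform on $\mathcal X^\beta$, where $\mathcal X$ is finite with $|\mathcal X|\ge 2$ and $\beta\ge 1$. The index $M$ of the requested file is uniform on $\{1,2\}$. A $(2,2)$ scheme consists of a random strategy $S$, independent of $M$; queries $Q_l=\phi_l(M,S)$ with values in finite sets $\mathcal Q_l$ ($l=1,2$), the pair $(M,S)$ being independent of the files; and answers $A_l=\varphi_l(Q_l,X^{(1)},X^{(2)})\in\mathcal A^{\ell_l(Q_l)}$ over a finite alphabet $\mathcal A$, whose length depends on the query only. It must satisfy $H(X^{(M)}\mid A_1,A_2,Q_1,Q_2,M)=0$. Its download cost is $\mathsf D=\log_2|\mathcal A|\sum_{l}\mathbb E[\ell_l(Q_l)]$, its rate is $\mathsf R=\beta\log_2|\mathcal X|/\mathsf D$, the maximal leakage of server $l$ is $\mathrm{MaxL}_l=\log_2\sum_{q\in\mathcal Q_l}\max_{m}\Pr[Q_l=q\mid M=m]$, and the maximal leakage of the scheme is $\mathrm{MaxL}=\max_l\mathrm{MaxL}_l$. Given a positive integer $\alpha$, the alphabet restrictions are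 $|\mathcal Q_l|\le\alpha$ and $|\mathcal A|^{\ell_l(q)}\le|\mathcal X|^\beta$ for all $l$ and all $q\in\mathcal Q_l$. **Scheme A** (two files, two servers). Take $\mathcal X=\mathcal A=\{0,1\}$, $\beta=1$, and let $S\in\{0,1\}$ be Bernoulli with $\Pr[S=1]=p$. The query $Q_l\in\{0,1\}^2$ has the entry $S$ at the position of the file that is not requested, and at the position of the requested file the entry that makes the sum of both entries congruent to $l-1$ modulo $2$. The answer to a query $(q_1,q_2)$ is $q_1X^{(1)}+q_2X^{(2)}\bmod 2$, of length $1$, except that the query $(0,0)$ has the empty answer. **Time-sharing Scheme A** exchanges the roles of the two servers with probability $1/2$, independently of $M$ and $S$, the query of each server also telling it its role. **Theorem.** Let $0\le\rho\le1$. 1. For every $\alpha\ge4$, the maximum of $\mathsf R$ over all $(2,2)$ schemes that satisfy the alphabet restrictions and have $\mathrm{MaxL}\le\rho$ exists and equals $$\mathsf R_{\max}(\rho)=\Bigl[\max\bigl\{1,\tfrac52-2^{\rho}\bigr\}\Bigr]^{-1},$$ that is, $\bigl[\tfrac52-2^\rho\bigr]^{-1}$ if $2^\rho\le\tfrac32$,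 and $1$ otherwise. It is achieved by time-sharing Scheme A with $p=\max\{0,\tfrac32-2^\rho\}$. 2. For every $\alpha\ge2$, the maximum of $\mathsf R$ over all $(2,2)$ schemes that satisfy the alphabet restrictions, have $\mathrm{MaxL}\le\rho$, and in which only one of the two servers may leak (that is, $\mathrm{MaxL}_l=0$ for at least one $l$) exists and equals $\bigl[2-2^{\rho-1}\bigr]^{-1}$. It is achieved by Scheme A with $p=1-2^{\rho-1}$. -/

import Mathlib

open MeasureTheory ProbabilityTheory
open scoped BigOperators unitInterval

noncomputable section

namespace WPIR

/-! ### Entropy of finite random variables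

A finite probability space is given by its weights `w : Ω → ℝ`. -/

/-- The law of the random variable `X` on the finite probability space with weights `w`. -/
def law {Ω α : Type} [Fintype Ω] (w : Ω → ℝ) (X : Ω → α) (a : α) : ℝ :=
  open Classical in ∑ ω, if X ω = a then w ω else 0

/-- The conditional entropy in bits,
`H(X | Y) = ∑ y, P(Y = y) * ∑ x, - P(X = x | Y = y) * log₂ P(X = x | Y = y)`. -/
def condEntropy {Ω α γ : Type} [Fintype Ω] [Fintype α] [Fintype γ]
    (w : Ω → ℝ) (X : Ω → α) (Y : Ω → γ) : ℝ :=
  (∑ y, law w Y y *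
    ∑ x, Real.negMulLog (law w (fun ω => (X ω, Y ω)) (x, y) / law w Y y)) / Real.log 2

/-! ### Information retrieval schemes -/

/-- The data of a scheme for `n` noncolluding replicated servers that store `M` files, each a
vector of `β` symbols from the alphabet `Sym`. Files and servers are indexed from `0`. -/
structure Scheme (M n : ℕ) where
  /-- alphabet of the file symbols -/
  Sym : Type
  [symFintype : Fintype Sym]
  /-- length of each file -/
  β : ℕ
  /-- alphabet of the global random strategy `S` -/
  Strategy : Type
  [strategyMeasurable : MeasurableSpace Strategy]
  /-- law of the global random strategy -/
  strategyLaw : Measure Strategy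
  [strategyProb : IsProbabilityMeasure strategyLaw]
  /-- alphabet of the query to server `l` -/
  Query : Fin n → Type
  [queryFintype : ∀ l, Fintype (Query l)]
  /-- the query to server `l`, as a function of the requested file index and the strategy -/
  encode : ∀ l, Fin M → Strategy → Query l
  measurable_encode : ∀ l m q, MeasurableSet (encode l m ⁻¹' {q})
  /-- alphabet of the downloaded symbols -/
  Down : Type
  [downFintype : Fintype Down]
  /-- length of the answer of server `l` -/
  ansLen : ∀ l, Query l → ℕ
  /-- answer of server `l`, a word of length `ansLen l q` -/
  answer : ∀ l (q : Query l), (Fin M → Fin β → Sym) → (Fin (ansLen l q) → Down)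
  /-- number of symbols accessed by server `l`; it enters neither the rate nor the leakage -/
  access : ∀ l, Query l → ℕ

attribute [instance] Scheme.symFintype Scheme.strategyMeasurable Scheme.strategyProb
  Scheme.queryFintype Scheme.downFintype

namespace Scheme

variable {M n : ℕ} (C : Scheme M n)

/-- The database: the contents of all `M` files. -/
abbrev Files : Type := Fin M → Fin C.β → C.Sym

/-- `P(Q₁ = q₁, …, Qₙ = qₙ | M = m)`. The strategy is independent of the requested index. -/
def jointQueryProb (m : Fin M) (q : ∀ l, C.Query l) : ℝ :=
  C.strategyLaw.real {s | ∀ l, C.encode l m s = q l}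

/-- `P(Q_l = q | M = m)`. -/
def queryProb (l : Fin n) (m : Fin M) (q : C.Query l) : ℝ :=
  C.strategyLaw.real {s | C.encode l m s = q}

/-- The sample space of the requested index, the queries and the files. -/
abbrev Outcome : Type := Fin M × (∀ l, C.Query l) × C.Files

/-- The joint law: the requested index is uniform, the queries are generated from it and the
strategy, and the files are uniform and independent of the index and the queries. -/
def weight : C.Outcome → ℝ := fun ω =>
  (1 / (M : ℝ)) * C.jointQueryProb ω.1 ω.2.1 * (1 / (Fintype.card C.Files : ℝ))

/-- What the user sees: the requested index, all queries, and all answers. -/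
abbrev Transcript : Type :=
  Fin M × (Σ q : (∀ l, C.Query l), ∀ l, (Fin (C.ansLen l (q l)) → C.Down))

/-- The random variable `(M, Q₁, …, Qₙ, A₁, …, Aₙ)`. -/
def transcript (ω : C.Outcome) : C.Transcript :=
  (ω.1, ⟨ω.2.1, fun l => C.answer l (ω.2.1 l) ω.2.2⟩)

/-- The random variable `X^(M)`, the content of the requested file. -/
def requestedFile (ω : C.Outcome) : Fin C.β → C.Sym := ω.2.2 ω.1

/-- Perfect retrievability, `H(X^(M) | A₁, …, Aₙ, Q₁, …, Qₙ, M) = 0`. -/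
def Retrievable : Prop :=
  condEntropy C.weight C.requestedFile C.transcript = 0

/-- An information retrieval scheme: the files have positive length over an alphabet with at
least two symbols, and retrievability is perfect. -/
def IsIR : Prop :=
  2 ≤ Fintype.card C.Sym ∧ 0 < C.β ∧ C.Retrievable

/-- The maximal leakage `log₂ ∑ q, max_m P(Q_l = q | M = m)` at server `l`. -/
def maxLAt (l : Fin n) : ℝ := Real.logb 2 (∑ q, ⨆ m, C.queryProb l m q)

/-- The maximal leakage of the scheme, the worst case over all servers. -/
def maxL : ℝ := ⨆ l, C.maxLAt l

/-- The download cost in bits, averaged over the uniform requested index. -/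
def downloadCost : ℝ :=
  Real.logb 2 (Fintype.card C.Down) *
    ((1 / (M : ℝ)) * ∑ m, ∑ l, ∑ q, C.queryProb l m q * (C.ansLen l q : ℝ))

/-- The rate: the number of bits of a file divided by the download cost. -/
def rate : ℝ := (C.β : ℝ) * Real.logb 2 (Fintype.card C.Sym) / C.downloadCost

/-- The restrictions on the alphabets: each query alphabet has at most `α` elements, and each
answer takes values in an alphabet that is no larger than that of a file. -/
def Restricted (α : ℕ) : Prop :=
  ∀ l, Fintype.card (C.Query l) ≤ α ∧
    ∀ q, Fintype.card C.Down ^ C.ansLen l q ≤ Fintype.card C.Sym ^ C.β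

/-- A retrieval scheme within the alphabet restrictions, with maximal leakage at most `ρ`. -/
def Admissible (α : ℕ) (ρ : ℝ) : Prop := C.IsIR ∧ C.Restricted α ∧ C.maxL ≤ ρ

/-- The time-sharing scheme: a uniform cyclic shift `t`, independent of the strategy, assigns to
server `l` the role of server `l + t` of `C`. The query names the role, so that the server
knows which answer function to apply. -/
def timeShare [NeZero n] : Scheme M n where
  Sym := C.Sym
  β := C.β
  Strategy := Fin n × C.Strategy
  strategyLaw := (PMF.uniformOfFintype (Fin n)).toMeasure.prod C.strategyLaw
  Query _ := Σ l, C.Query l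
  encode l m ts := ⟨l + ts.1, C.encode (l + ts.1) m ts.2⟩
  measurable_encode := by
    rintro l m ⟨l', q⟩
    have h : ((fun ts : Fin n × C.Strategy =>
        (⟨l + ts.1, C.encode (l + ts.1) m ts.2⟩ : Σ l, C.Query l)) ⁻¹' {⟨l', q⟩}) =
        {t | l + t = l'} ×ˢ (C.encode l' m ⁻¹' {q}) := by
      ext ⟨t, s⟩
      simp only [Set.mem_preimage, Set.mem_singleton_iff, Set.mem_prod, Set.mem_ofPred_eq]
      constructor
      · intro h
        rw [Sigma.mk.injEq] at h
        obtain ⟨h1, h2⟩ := h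
        subst h1
        exact ⟨rfl, eq_of_heq h2⟩
      · rintro ⟨rfl, rfl⟩
        rfl
    rw [h]
    exact (Set.toFinite _).measurableSet.prod (C.measurable_encode l' m q)
  Down := C.Down
  ansLen _ q := C.ansLen q.1 q.2
  answer _ q x := C.answer q.1 q.2 x
  access _ q := C.access q.1 q.2

end Scheme

/-! ### Scheme A -/

/-- The symbol of a binary file of length `n - 1` at position `j ∈ {0, …, n - 1}`, where
positions are counted from `1` and the symbol at position `0` is `0` by convention. -/
def symbolAt {n : ℕ} (x : Fin (n - 1) → ZMod 2) (j : Fin n) : ZMod 2 :=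
  if h : j.val = 0 then 0 else x ⟨j.val - 1, by omega⟩

/-- Scheme A for `k + 1` binary files of length `n - 1` and `n` servers, with a random strategy
`S ∈ {0, …, n - 1} ^ k` of law `P`. The query to server `l` is the vector `S` with one more
entry, inserted at the position of the requested file, that makes the sum of all entries equal
to `l` modulo `n`. The answer is the sum of the symbols to which the entries point; the zero
query has the empty answer. -/
def schemeA (k n : ℕ) [NeZero n] (P : Measure (Fin k → Fin n)) [IsProbabilityMeasure P] :
    Scheme (k + 1) n where
  Sym := ZMod 2
  symFintype := inferInstanceAs (Fintype (Fin 2))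
  β := n - 1
  Strategy := Fin k → Fin n
  strategyLaw := P
  Query l := {q : Fin (k + 1) → Fin n // ∑ i, q i = l}
  encode l m s := ⟨m.insertNth (l - ∑ j, s j) s, by
    rw [Fin.sum_univ_succAbove _ m]
    simp⟩
  measurable_encode _ _ _ := (Set.toFinite _).measurableSet
  Down := ZMod 2
  downFintype := inferInstanceAs (Fintype (Fin 2))
  ansLen _ q := if q.1 = 0 then 0 else 1
  answer _ q x := fun _ => ∑ i, symbolAt (x i) (q.1 i)
  access _ q := (Finset.univ.filter fun i => q.1 i ≠ 0).card

/-- The law of a strategy whose `k` entries are i.i.d. Bernoulli, equal to `1` with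
probability `p` and to `0` with probability `1 - p`. -/
abbrev bernoulliStrategy (k : ℕ) (p : I) : Measure (Fin k → Fin 2) :=
  Measure.pi fun _ => bernoulliMeasure (1 : Fin 2) 0 p

end WPIR

end

namespace WPIR

/-! ### Vanishing conditional entropy -/

section Entropy

variable {Ω α γ : Type} [Fintype Ω]

/-! Converse: write `L` for the log-size of a file and `r_m(l, q)` for the average, over the
contents of file `m`, of the log-number of answers to `q` when file `m` is held fixed (`residual`).
Three facts combine. If the other file is requested, the two answers must still determine it once
file `m` is known, so the two residuals add up to at least `L` (`le_residual_add`). If `m` itself is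
requested, the answers encode file `m`, and on top of that the answer of either single server takes
its residual range of values; hence the total answer length, in the same log units, is at least `L +
r_m(l, q_l)` for each `l` (`add_residual_le`), and averaging over `l` gives `L` plus half the sum of
the residuals. Finally a server sees only its own query, and residuals lie in `[0, L]`, so switching
the requested file changes an expected residual by at most `L (s_l - 1)`, where `s_l` is the sum
inside the logarithm of the maximal leakage (`sum_queryProb_mul_le`). Together the cost is at least
`L + L (3 - s_0 - s_1) / 2`, and trivially at least `L` (`le_downloadCost`). Achievability: Scheme A
costs `1 + p` and has `s_0 = 1`, `s_1 = 2 max(p, 1 - p)`. Time sharing replaces both sums by their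
average and keeps the cost, and the stated values of `p` meet the bound. -/

lemma law_nonneg {w : Ω → ℝ} (hw : ∀ ω, 0 ≤ w ω) (X : Ω → α) (a : α) : 0 ≤ law w X a :=
  Finset.sum_nonneg fun ω _ => by split_ifs <;> simp [hw]

lemma law_pos {w : Ω → ℝ} (hw : ∀ ω, 0 ≤ w ω) (X : Ω → α) {ω : Ω} (h : 0 < w ω) :
    0 < law w X (X ω) := by
  classical
  refine Finset.sum_pos' (fun ω' _ => by split_ifs <;> simp [hw]) ⟨ω, Finset.mem_univ _, ?_⟩
  simpa using h

lemma law_pair_le {w : Ω → ℝ} (hw : ∀ ω, 0 ≤ w ω) (X : Ω → α) (Y : Ω → γ) (x : α) (y : γ) :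
    law w (fun ω => (X ω, Y ω)) (x, y) ≤ law w Y y := by
  refine Finset.sum_le_sum fun ω _ => ?_
  by_cases h : Y ω = y
  · simp only [Prod.mk.injEq, h, and_true, if_true]
    split_ifs <;> simp [hw]
  · simp [h]

/-- Conditional entropy vanishes if and only if the conditioning variable determines the other
one on the support. -/
lemma condEntropy_eq_zero_iff [Fintype α] [Fintype γ] {w : Ω → ℝ} (hw : ∀ ω, 0 ≤ w ω)
    (X : Ω → α) (Y : Ω → γ) :
    condEntropy w X Y = 0 ↔
      ∀ ω ω', 0 < w ω → 0 < w ω' → Y ω = Y ω' → X ω = X ω' := by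
  have hr0 : ∀ x y, 0 ≤ law w (fun ω => (X ω, Y ω)) (x, y) / law w Y y := fun x y =>
    div_nonneg (law_nonneg hw _ _) (law_nonneg hw _ _)
  have hr1 : ∀ x y, law w (fun ω => (X ω, Y ω)) (x, y) / law w Y y ≤ 1 := fun x y =>
    div_le_one_of_le₀ (law_pair_le hw X Y x y) (law_nonneg hw _ _)
  have hterm : ∀ x y,
      0 ≤ Real.negMulLog (law w (fun ω => (X ω, Y ω)) (x, y) / law w Y y) := fun x y =>
    Real.negMulLog_nonneg (hr0 x y) (hr1 x y)
  have hlog : Real.log 2 ≠ 0 := (Real.log_pos one_lt_two).ne'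
  rw [condEntropy, div_eq_zero_iff, or_iff_left hlog,
    Finset.sum_eq_zero_iff_of_nonneg fun y _ =>
      mul_nonneg (law_nonneg hw _ _) (Finset.sum_nonneg fun x _ => hterm x y)]
  constructor
  · intro h ω ω' hω hω' hY
    by_contra hX
    have hy := law_pos hw Y hω
    have hxy := law_pos hw (fun ω => (X ω, Y ω)) hω
    have h1 := (mul_eq_zero.1 (h (Y ω) (Finset.mem_univ _))).resolve_left hy.ne'
    rw [Finset.sum_eq_zero_iff_of_nonneg fun x _ => hterm x _] at h1
    have h2 := h1 (X ω) (Finset.mem_univ _)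
    have hrpos : 0 < law w (fun ω => (X ω, Y ω)) (X ω, Y ω) / law w Y (Y ω) := div_pos hxy hy
    -- The outcome `ω'` counts towards the event for `Y` but not towards the joint event, so the
    -- conditional probability lies strictly between 0 and 1, where `negMulLog` does not vanish.
    have hlt : law w (fun ω => (X ω, Y ω)) (X ω, Y ω) < law w Y (Y ω) := by
      refine Finset.sum_lt_sum (fun ω₁ _ => ?_) ⟨ω', Finset.mem_univ _, ?_⟩
      · by_cases h : Y ω₁ = Y ω
        · simp only [Prod.mk.injEq, h, and_true, if_true]
          split_ifs <;> simp [hw]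
        · simp [h]
      · simp only [Prod.mk.injEq, hY.symm, and_true, if_true]
        rw [if_neg fun h => hX (congrArg Prod.fst h).symm]
        exact hω'
    rw [Real.negMulLog, mul_eq_zero, neg_eq_zero] at h2
    have h3 := Real.log_neg hrpos ((div_lt_one hy).2 hlt)
    rcases h2 with h2 | h2
    · exact hrpos.ne' h2
    · exact h3.ne h2
  · intro h y _
    by_cases hy : law w Y y = 0
    · simp [hy]
    refine mul_eq_zero_of_right _ (Finset.sum_eq_zero fun x _ => ?_)
    -- Each conditional probability is 1 or 0 according to whether `x` occurs with `y` on the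
    -- support, and `negMulLog` vanishes at both.
    by_cases hex : ∃ ω, 0 < w ω ∧ Y ω = y ∧ X ω = x
    · obtain ⟨ω, hω, rfl, rfl⟩ := hex
      have : law w (fun ω => (X ω, Y ω)) (X ω, Y ω) = law w Y (Y ω) := by
        refine Finset.sum_congr rfl fun ω' _ => ?_
        rcases (hw ω').eq_or_lt with h0 | h0
        · simp [← h0]
        · by_cases hY : Y ω' = Y ω
          · simp [hY, h ω' ω h0 hω hY]
          · simp [hY]
      rw [this, div_self hy, Real.negMulLog_one]
    · have : law w (fun ω => (X ω, Y ω)) (x, y) = 0 := by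
        refine Finset.sum_eq_zero fun ω _ => ?_
        by_cases hxy : (X ω, Y ω) = (x, y)
        · rw [if_pos hxy]
          rw [Prod.mk.injEq] at hxy
          refine le_antisymm (not_lt.1 fun h0 => hex ⟨ω, h0, hxy.2, hxy.1⟩) (hw ω)
        · rw [if_neg hxy]
      rw [this, zero_div, Real.negMulLog_zero]

end Entropy

/-! ### Average logarithmic image size -/

section Image

variable {W T T' : Type} [Fintype W]

/-- The average over `u` of the logarithm of the number of values of `f u`. -/
noncomputable def avgLogImage (f : W → W → T) : ℝ :=
  open Classical in
  ∑ u, (Fintype.card W : ℝ)⁻¹ * Real.log (Finset.univ.image (f u)).card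

lemma avgLogImage_nonneg (f : W → W → T) : 0 ≤ avgLogImage f :=
  Finset.sum_nonneg fun _ _ => mul_nonneg (by positivity) (Real.log_natCast_nonneg _)

lemma card_image_pos [Nonempty W] [DecidableEq T] (f : W → T) : 0 < (Finset.univ.image f).card :=
  Finset.card_pos.2 (Finset.univ_nonempty.image f)

lemma sum_inv_card_mul [Nonempty W] (c : ℝ) : ∑ _u : W, (Fintype.card W : ℝ)⁻¹ * c = c := by
  simp [Finset.sum_const, Finset.card_univ]

lemma avgLogImage_le [Nonempty W] (f : W → W → T) : avgLogImage f ≤ Real.log (Fintype.card W) := by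
  classical
  rw [← sum_inv_card_mul (W := W) (Real.log (Fintype.card W))]
  refine Finset.sum_le_sum fun u _ => mul_le_mul_of_nonneg_left (Real.log_le_log ?_ ?_) ?_
  · exact_mod_cast card_image_pos _
  · exact_mod_cast Finset.card_image_le
  · positivity

/-- If `f u v` and `g u v` determine `v` for given `u`, then `f` and `g` together take as many
values as there are files. -/
lemma log_card_le_avgLogImage_add [Nonempty W] (f : W → W → T) (g : W → W → T')
    (h : ∀ u v v', f u v = f u v' → g u v = g u v' → v = v') :
    Real.log (Fintype.card W) ≤ avgLogImage f + avgLogImage g := by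
  classical
  rw [← sum_inv_card_mul (W := W) (Real.log (Fintype.card W)), avgLogImage, avgLogImage,
    ← Finset.sum_add_distrib]
  refine Finset.sum_le_sum fun u _ => ?_
  have hf := card_image_pos (f u)
  have hg := card_image_pos (g u)
  rw [← mul_add, ← Real.log_mul (by positivity) (by positivity)]
  refine mul_le_mul_of_nonneg_left (Real.log_le_log (by exact_mod_cast Fintype.card_pos) ?_)
    (by positivity)
  norm_cast
  rw [← Finset.card_product, ← Finset.card_univ]
  refine Finset.card_le_card_of_injOn (fun v => (f u v, g u v)) (fun v _ => by simp) ?_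
  intro v _ v' _ hv
  exact h u v v' (congrArg Prod.fst hv) (congrArg Prod.snd hv)

/-- If `f u v` and `g u v` determine `u`, then their joint alphabet has room for `u` and for the
values of `f u`. -/
lemma log_card_add_avgLogImage_le [Nonempty W] [Fintype T] [Fintype T']
    (f : W → W → T) (g : W → W → T')
    (h : ∀ u v u' v', f u v = f u' v' → g u v = g u' v' → u = u') :
    Real.log (Fintype.card W) + avgLogImage f ≤
      Real.log (Fintype.card T * Fintype.card T') := by
  classical
  have hW : (0 : ℝ) < Fintype.card W := by exact_mod_cast Fintype.card_pos
  -- Pairs `(u, t)` with `t` a value of `f u` inject into the joint alphabet: choose `v` with `f u v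
  -- = t` and send the pair to `(t, g u v)`, from which `u` can be recovered.
  have hcard : ∑ u, (Finset.univ.image (f u)).card ≤ Fintype.card T * Fintype.card T' := by
    rw [← Finset.card_sigma, ← Fintype.card_prod, ← Finset.card_univ]
    have hex : ∀ p : (Σ _ : W, T), p ∈ Finset.univ.sigma (fun u => Finset.univ.image (f u)) →
        ∃ v, f p.1 v = p.2 := fun p hp => by simpa using hp
    choose! v hv using hex
    refine Finset.card_le_card_of_injOn (fun p => (p.2, g p.1 (v p))) (by simp [Set.MapsTo]) ?_
    intro p hp p' hp' hpp
    have h1 : p.2 = p'.2 := congrArg Prod.fst hpp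
    have h2 : p.1 = p'.1 := h _ (v p) _ (v p') (by rw [hv p hp, hv p' hp', h1])
      (congrArg Prod.snd hpp)
    exact Sigma.ext h2 (heq_of_eq h1)
  have hpos : ∀ u, (0 : ℝ) < (Finset.univ.image (f u)).card := fun u => by
    exact_mod_cast card_image_pos (f u)
  -- Jensen's inequality for the logarithm, which turns the average of logarithms into the logarithm
  -- of the average count.
  have hj : avgLogImage f ≤
      Real.log (∑ u, (Fintype.card W : ℝ)⁻¹ * ((Finset.univ.image (f u)).card : ℝ)) := by
    have := strictConcaveOn_log_Ioi.concaveOn.le_map_sum (t := Finset.univ)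
      (w := fun _ : W => (Fintype.card W : ℝ)⁻¹)
      (p := fun u => ((Finset.univ.image (f u)).card : ℝ)) (fun _ _ => by positivity)
      (by simp) (fun u _ => hpos u)
    simpa [avgLogImage] using this
  rw [← Finset.mul_sum] at hj
  have hs : (0 : ℝ) < ∑ u, ((Finset.univ.image (f u)).card : ℝ) :=
    Finset.sum_pos (fun u _ => hpos u) Finset.univ_nonempty
  calc _ ≤ Real.log (Fintype.card W) +
        Real.log ((Fintype.card W : ℝ)⁻¹ * ∑ u, ((Finset.univ.image (f u)).card : ℝ)) := by gcongr
    _ = Real.log (∑ u, ((Finset.univ.image (f u)).card : ℝ)) := by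
        rw [← Real.log_mul (by positivity) (by positivity), mul_inv_cancel_left₀ hW.ne']
    _ ≤ _ := Real.log_le_log hs (by exact_mod_cast hcard)

end Image

/-! ### Query probabilities -/

namespace Scheme

variable {M n : ℕ} (C : Scheme M n)

lemma measureReal_setOf_comp_eq_sum {S T : Type} [MeasurableSpace S] [Fintype T] (μ : Measure S)
    [IsFiniteMeasure μ] (F : S → T) (hF : ∀ t, MeasurableSet (F ⁻¹' {t})) (p : T → Prop)
    [DecidablePred p] :
    μ.real {s | p (F s)} = ∑ t, if p t then μ.real {s | F s = t} else 0 := by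
  rw [← Finset.sum_filter]
  have := sum_measureReal_preimage_singleton (μ := μ) (f := F) (Finset.univ.filter p)
    (fun y _ => hF y)
  rw [show {s | p (F s)} = F ⁻¹' ↑(Finset.univ.filter p) by ext; simp, ← this]
  rfl

lemma measurableSet_encode_eq (m : Fin M) (q : ∀ l, C.Query l) :
    MeasurableSet ((fun s l => C.encode l m s) ⁻¹' {q}) := by
  have : (fun s l => C.encode l m s) ⁻¹' {q} = ⋂ l, C.encode l m ⁻¹' {q l} := by
    ext s; simp [funext_iff]
  rw [this]
  exact MeasurableSet.iInter fun l => C.measurable_encode l m (q l)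

lemma jointQueryProb_nonneg (m : Fin M) (q : ∀ l, C.Query l) : 0 ≤ C.jointQueryProb m q :=
  measureReal_nonneg

lemma queryProb_nonneg (l : Fin n) (m : Fin M) (q : C.Query l) : 0 ≤ C.queryProb l m q :=
  measureReal_nonneg

lemma sum_jointQueryProb (m : Fin M) : ∑ q, C.jointQueryProb m q = 1 := by
  have := measureReal_setOf_comp_eq_sum C.strategyLaw (fun s l => C.encode l m s)
    (C.measurableSet_encode_eq m) (fun _ => True)
  simpa [jointQueryProb, funext_iff] using this.symm

lemma sum_queryProb (l : Fin n) (m : Fin M) : ∑ q, C.queryProb l m q = 1 := by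
  have := measureReal_setOf_comp_eq_sum C.strategyLaw (C.encode l m)
    (C.measurable_encode l m) (fun _ => True)
  simpa [queryProb] using this.symm

/-- The expectation of a function of one query, computed from the joint law of all queries. -/
lemma sum_queryProb_mul (l : Fin n) (m : Fin M) (f : C.Query l → ℝ) :
    ∑ q, C.queryProb l m q * f q = ∑ q, C.jointQueryProb m q * f (q l) := by
  classical
  have h : ∀ q, C.queryProb l m q = ∑ q', if q' l = q then C.jointQueryProb m q' else 0 :=
    fun q => by
      have := measureReal_setOf_comp_eq_sum C.strategyLaw (fun s l => C.encode l m s)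
        (C.measurableSet_encode_eq m) (fun q' => q' l = q)
      simpa [queryProb, jointQueryProb, funext_iff] using this
  simp_rw [h, Finset.sum_mul]
  rw [Finset.sum_comm]
  simp [ite_mul]

/-! ### Retrievability -/

lemma weight_nonneg (ω : C.Outcome) : 0 ≤ C.weight ω :=
  mul_nonneg (mul_nonneg (by positivity) (C.jointQueryProb_nonneg _ _)) (by positivity)

/-- Files are uniform and independent of the queries, so an outcome has positive weight exactly when
its query tuple has positive probability. This makes retrievability a decoding condition free of
entropy. -/
lemma retrievable_iff : C.Retrievable ↔ ∀ m q, 0 < C.jointQueryProb m q →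
    ∀ x x' : C.Files, (∀ l, C.answer l (q l) x = C.answer l (q l) x') → x m = x' m := by
  rw [Retrievable, condEntropy_eq_zero_iff C.weight_nonneg]
  constructor
  · intro h m q hq x x' hx
    have hpos : ∀ y : C.Files, 0 < C.weight (m, q, y) := fun y => by
      have : 0 < M := m.pos
      have : 0 < Fintype.card C.Files := Fintype.card_pos_iff.2 ⟨y⟩
      exact mul_pos (mul_pos (by positivity) hq) (by positivity)
    refine h (m, q, x) (m, q, x') (hpos x) (hpos x') ?_
    simp only [transcript, Prod.mk.injEq, Sigma.mk.injEq, heq_eq_eq, true_and]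
    exact funext hx
  · rintro h ⟨m, q, x⟩ ⟨m', q', x'⟩ hω - hY
    simp only [transcript, Prod.mk.injEq, Sigma.mk.injEq] at hY
    obtain ⟨rfl, rfl, hY⟩ := hY
    refine h m q ?_ x x' fun l => congrFun (eq_of_heq hY) l
    refine (C.jointQueryProb_nonneg m q).lt_of_ne fun h0 => ?_
    simp [weight, ← h0] at hω

/-- A query tuple of positive probability is produced by at least one strategy, so decoding may be
checked strategy by strategy. -/
lemma Retrievable.of_encode (h : ∀ m s, ∀ x x' : C.Files,
    (∀ l, C.answer l (C.encode l m s) x = C.answer l (C.encode l m s) x') → x m = x' m) :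
    C.Retrievable := by
  refine C.retrievable_iff.2 fun m q hq => ?_
  have hne : {s | ∀ l, C.encode l m s = q l}.Nonempty := by
    by_contra hne
    rw [Set.not_nonempty_iff_eq_empty] at hne
    simp [jointQueryProb, hne] at hq
  obtain ⟨s, hs⟩ := hne
  obtain rfl : (fun l => C.encode l m s) = q := funext hs
  exact h m s

/-! ### Leakage -/

lemma queryProb_le_iSup (l : Fin n) (m : Fin M) (q : C.Query l) :
    C.queryProb l m q ≤ ⨆ m, C.queryProb l m q :=
  le_ciSup (f := fun m => C.queryProb l m q) (Set.finite_range _).bddAbove m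

/-- The maxima dominate the law for one fixed index. This keeps the argument of the logarithm in the
leakage positive, as passing between logarithms and powers requires. -/
lemma one_le_sum_iSup [NeZero M] (l : Fin n) : 1 ≤ ∑ q, ⨆ m, C.queryProb l m q := by
  rw [← C.sum_queryProb l 0]
  exact Finset.sum_le_sum fun q _ => C.queryProb_le_iSup l 0 q

lemma sum_iSup_le_rpow [NeZero M] {ρ : ℝ} (h : C.maxL ≤ ρ) (l : Fin n) :
    ∑ q, ⨆ m, C.queryProb l m q ≤ (2 : ℝ) ^ ρ := by
  have h1 : C.maxLAt l ≤ ρ :=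
    (le_ciSup (f := C.maxLAt) (Set.finite_range _).bddAbove l).trans h
  exact (Real.logb_le_iff_le_rpow one_lt_two (zero_lt_one.trans_le (C.one_le_sum_iSup l))).1 h1

lemma sum_iSup_eq_one [NeZero M] {l : Fin n} (h : C.maxLAt l = 0) :
    ∑ q, ⨆ m, C.queryProb l m q = 1 := by
  have h1 := C.one_le_sum_iSup l
  refine le_antisymm ?_ h1
  have := (Real.logb_le_iff_le_rpow one_lt_two (zero_lt_one.trans_le h1)).1 h.le
  simpa using this

/-- Changing the requested file changes the expectation of a function of one query by at most
its range times the excess of the maximal leakage sum over `1`. -/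
lemma sum_queryProb_mul_le {l : Fin n} (m m' : Fin M) {f : C.Query l → ℝ} {L : ℝ}
    (h0 : ∀ q, 0 ≤ f q) (hL : ∀ q, f q ≤ L) :
    ∑ q, C.queryProb l m' q * f q ≤
      ∑ q, C.queryProb l m q * f q + L * (∑ q, (⨆ m, C.queryProb l m q) - 1) := by
  rw [← C.sum_queryProb l m, ← Finset.sum_sub_distrib, Finset.mul_sum, ← Finset.sum_add_distrib]
  refine Finset.sum_le_sum fun q _ => ?_
  have h1 := C.queryProb_le_iSup l m q
  have h2 := C.queryProb_le_iSup l m' q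
  -- With `P`, `P'` the two probabilities and `S` their bound: `P' f ≤ S f = P f + (S - P) f ≤ P f +
  -- (S - P) L`.
  nlinarith [mul_le_mul_of_nonneg_right h2 (h0 q),
    mul_le_mul_of_nonneg_left (hL q) (sub_nonneg.2 h1)]

end Scheme

/-! ### The converse for two files and two servers -/

namespace Scheme

variable (C : Scheme 2 2)

/-- The database with file `m` equal to `u` and the other file equal to `v`. -/
def pairFiles (m : Fin 2) (u v : Fin C.β → C.Sym) : C.Files := fun i => if i = m then u else v

/-- The average logarithmic number of answers to `q` for given content of file `m`. -/
noncomputable def residual (m : Fin 2) (l : Fin 2) (q : C.Query l) : ℝ :=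
  avgLogImage fun u v => C.answer l q (C.pairFiles m u v)

variable {C}

lemma IsIR.nonempty_file (h : C.IsIR) : Nonempty (Fin C.β → C.Sym) := by
  have : Nonempty C.Sym := Fintype.card_pos_iff.1 (by have := h.1; omega)
  infer_instance

lemma log_card_file : Real.log (Fintype.card (Fin C.β → C.Sym)) =
    C.β * Real.log (Fintype.card C.Sym) := by
  simp [Real.log_pow]

lemma residual_nonneg (m l : Fin 2) (q : C.Query l) : 0 ≤ C.residual m l q :=
  avgLogImage_nonneg _

/-- With file `m` fixed, the answer is a function of the other file alone, so it has at most as many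
values as there are files. -/
lemma residual_le (h : C.IsIR) (m l : Fin 2) (q : C.Query l) :
    C.residual m l q ≤ C.β * Real.log (Fintype.card C.Sym) := by
  have := h.nonempty_file
  rw [← log_card_file]
  exact avgLogImage_le _

/-- Fixing the unrequested file `m'`, the two answers must separate all contents of the requested
file `m`. -/
lemma le_residual_add (h : C.IsIR) {m m' : Fin 2} (hm : m ≠ m') {q : ∀ l, C.Query l}
    (hq : 0 < C.jointQueryProb m q) :
    C.β * Real.log (Fintype.card C.Sym) ≤
      C.residual m' 0 (q 0) + C.residual m' 1 (q 1) := by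
  have := h.nonempty_file
  rw [← log_card_file]
  refine log_card_le_avgLogImage_add _ _ fun u v v' h0 h1 => ?_
  have := C.retrievable_iff.1 h.2.2 m q hq _ _ (Fin.forall_fin_two.2 ⟨h0, h1⟩)
  simpa [pairFiles, hm] using this

/-- The pair of answers determines file `m`, while for each content of it the answer of server `l`
still ranges over its residual set; the joint answer alphabet must have room for both. -/
lemma add_residual_le (h : C.IsIR) {m : Fin 2} {q : ∀ l, C.Query l}
    (hq : 0 < C.jointQueryProb m q) (l : Fin 2) :
    C.β * Real.log (Fintype.card C.Sym) + C.residual m l (q l) ≤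
      Real.log (Fintype.card C.Down) * (C.ansLen 0 (q 0) + C.ansLen 1 (q 1)) := by
  have := h.nonempty_file
  rw [← log_card_file]
  have hdec : ∀ u v u' v', (∀ l, C.answer l (q l) (C.pairFiles m u v) =
      C.answer l (q l) (C.pairFiles m u' v')) → u = u' := fun u v u' v' hl => by
    simpa [pairFiles] using C.retrievable_iff.1 h.2.2 m q hq _ _ hl
  have hlog : ∀ a b : ℕ, Real.log
      ((Fintype.card (Fin a → C.Down) : ℝ) * (Fintype.card (Fin b → C.Down) : ℝ)) =
      Real.log (Fintype.card C.Down) * (a + b) := fun a b => by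
    simp only [Fintype.card_pi, Finset.prod_const, Finset.card_univ, Fintype.card_fin]
    push_cast
    rw [← pow_add, Real.log_pow]
    push_cast
    ring
  fin_cases l
  · rw [← hlog]
    exact log_card_add_avgLogImage_le _ _ fun u v u' v' h0 h1 =>
      hdec u v u' v' (Fin.forall_fin_two.2 ⟨h0, h1⟩)
  · rw [add_comm (C.ansLen 0 (q 0) : ℝ), ← hlog]
    exact log_card_add_avgLogImage_le _ _ fun u v u' v' h1 h0 =>
      hdec u v u' v' (Fin.forall_fin_two.2 ⟨h0, h1⟩)

/-- The expectation of a sum of functions of single queries, computed from the joint law. -/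
lemma sum_queryProb_mul_add (m : Fin 2) (f : ∀ l, C.Query l → ℝ) :
    ∑ l, ∑ q, C.queryProb l m q * f l q =
      ∑ q, C.jointQueryProb m q * (f 0 (q 0) + f 1 (q 1)) := by
  rw [Fin.sum_univ_two, C.sum_queryProb_mul, C.sum_queryProb_mul, ← Finset.sum_add_distrib]
  simp_rw [mul_add]

/-- Decoding constrains only query tuples of positive probability; the others carry no weight. -/
lemma le_sum_jointQueryProb_mul (m : Fin 2) {f : (∀ l, C.Query l) → ℝ} {L : ℝ}
    (h : ∀ q, 0 < C.jointQueryProb m q → L ≤ f q) : L ≤ ∑ q, C.jointQueryProb m q * f q := by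
  rw [← one_mul L, ← C.sum_jointQueryProb m, Finset.sum_mul]
  refine Finset.sum_le_sum fun q _ => ?_
  rcases (C.jointQueryProb_nonneg m q).eq_or_lt with h0 | h0
  · simp [← h0]
  · exact mul_le_mul_of_nonneg_left (h q h0) h0.le

/-- The expected residual when the other file is requested is at least the file size. -/
lemma le_sum_queryProb_mul_residual (h : C.IsIR) {m m' : Fin 2} (hm : m ≠ m') :
    C.β * Real.log (Fintype.card C.Sym) ≤
      ∑ l, ∑ q, C.queryProb l m q * C.residual m' l q := by
  rw [sum_queryProb_mul_add]
  exact le_sum_jointQueryProb_mul m fun q hq => le_residual_add h hm hq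

/-- The factor `1/2` comes from averaging `add_residual_le` over the two choices of server. -/
lemma le_log_mul_sum_ansLen (h : C.IsIR) (m : Fin 2) :
    C.β * Real.log (Fintype.card C.Sym) +
        (∑ l, ∑ q, C.queryProb l m q * C.residual m l q) / 2 ≤
      Real.log (Fintype.card C.Down) * ∑ l, ∑ q, C.queryProb l m q * (C.ansLen l q : ℝ) := by
  rw [sum_queryProb_mul_add m (fun l => C.residual m l),
    sum_queryProb_mul_add m (fun l q => (C.ansLen l q : ℝ)), ← sub_nonneg]
  have := le_sum_jointQueryProb_mul (C := C) m (L := C.β * Real.log (Fintype.card C.Sym))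
    (f := fun q => Real.log (Fintype.card C.Down) * (C.ansLen 0 (q 0) + C.ansLen 1 (q 1)) -
      (C.residual m 0 (q 0) + C.residual m 1 (q 1)) / 2) fun q hq => by
      have h0 := add_residual_le h hq 0
      have h1 := add_residual_le h hq 1
      linarith
  have he : ∑ q, C.jointQueryProb m q * (Real.log (Fintype.card C.Down) *
        (C.ansLen 0 (q 0) + C.ansLen 1 (q 1)) -
        (C.residual m 0 (q 0) + C.residual m 1 (q 1)) / 2) =
      Real.log (Fintype.card C.Down) *
        (∑ q, C.jointQueryProb m q * ((C.ansLen 0 (q 0) : ℝ) + C.ansLen 1 (q 1))) -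
      (∑ q, C.jointQueryProb m q * (C.residual m 0 (q 0) + C.residual m 1 (q 1))) / 2 := by
    rw [Finset.mul_sum, Finset.sum_div, ← Finset.sum_sub_distrib]
    exact Finset.sum_congr rfl fun q _ => by ring
  rw [he] at this
  linarith

lemma downloadCost_eq : C.downloadCost = (1 / 2 * ∑ m, Real.log (Fintype.card C.Down) *
    ∑ l, ∑ q, C.queryProb l m q * (C.ansLen l q : ℝ)) / Real.log 2 := by
  rw [downloadCost, Real.logb, ← Finset.mul_sum]
  push_cast
  ring

/-- A lower bound on the download cost in terms of the leakage of both servers. -/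
lemma le_downloadCost (h : C.IsIR) :
    C.β * Real.logb 2 (Fintype.card C.Sym) *
        max 1 (5 / 2 - (∑ l, ∑ q, ⨆ m, C.queryProb l m q) / 2) ≤ C.downloadCost := by
  set L : ℝ := C.β * Real.log (Fintype.card C.Sym) with hL
  have hL0 : 0 ≤ L := mul_nonneg (by positivity) (Real.log_natCast_nonneg _)
  have hnn : ∀ m, 0 ≤ ∑ l, ∑ q, C.queryProb l m q * C.residual m l q := fun m =>
    Finset.sum_nonneg fun l _ => Finset.sum_nonneg fun q _ =>
      mul_nonneg (C.queryProb_nonneg _ _ _) (residual_nonneg _ _ _)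
  -- The lower bound on the residuals of file `m'` holds under the request `m`; moving it to the
  -- request `m'` costs the leakage excess of each server.
  have htv : ∀ m m', m ≠ m' → L ≤ ∑ l, ∑ q, C.queryProb l m' q * C.residual m' l q +
      L * (∑ l, ∑ q, (⨆ m, C.queryProb l m q) - 2) := fun m m' hm => by
    have h1 := le_sum_queryProb_mul_residual h hm
    have h2 : ∀ l, _ := fun l => C.sum_queryProb_mul_le (l := l) m' m
      (residual_nonneg m' l) (residual_le h m' l)
    have h20 := h2 0
    have h21 := h2 1
    simp only [Fin.sum_univ_two (f := fun l => ∑ q, _)] at h1 ⊢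
    simp only [← hL] at h1 h20 h21
    linarith
  have hd0 := le_log_mul_sum_ansLen h 0
  have hd1 := le_log_mul_sum_ansLen h 1
  have h01 := htv 0 1 (by decide)
  have h10 := htv 1 0 (by decide)
  have hn0 := hnn 0
  have hn1 := hnn 1
  rw [downloadCost_eq, le_div_iff₀ (Real.log_pos one_lt_two), Fin.sum_univ_two
    (f := fun m : Fin 2 => Real.log (Fintype.card C.Down) * ∑ l, ∑ q, C.queryProb l m q * (C.ansLen l q : ℝ))]
  have he : C.β * Real.logb 2 (Fintype.card C.Sym) *
      max 1 (5 / 2 - (∑ l, ∑ q, ⨆ m, C.queryProb l m q) / 2) * Real.log 2 =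
      L * max 1 (5 / 2 - (∑ l, ∑ q, ⨆ m, C.queryProb l m q) / 2) := by
    have := (Real.log_pos one_lt_two).ne'
    rw [hL, Real.logb]
    field_simp
  rw [he, mul_max_of_nonneg _ _ hL0]
  -- The bound 1 uses only nonnegativity of the residuals. The other one inserts `htv` for both
  -- files and averages: `1 + (3 - s_0 - s_1) / 2 = 5/2 - (s_0 + s_1) / 2`.
  refine max_le ?_ ?_
  · linarith
  · linarith

lemma rate_le (h : C.IsIR) {K : ℝ} (hK : 0 < K)
    (hD : C.β * Real.logb 2 (Fintype.card C.Sym) * K ≤ C.downloadCost) : C.rate ≤ K⁻¹ := by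
  have hpos : 0 < C.β * Real.logb 2 (Fintype.card C.Sym) :=
    mul_pos (by exact_mod_cast h.2.1) (Real.logb_pos one_lt_two (by exact_mod_cast h.1))
  rw [rate, inv_eq_one_div, div_le_div_iff₀ ((mul_pos hpos hK).trans_le hD) hK, one_mul]
  exact hD

lemma rate_le_of_maxL_le (h : C.IsIR) {ρ : ℝ} (hρ : C.maxL ≤ ρ) :
    C.rate ≤ (max 1 (5 / 2 - (2 : ℝ) ^ ρ))⁻¹ := by
  refine rate_le h (by positivity) (le_trans ?_ (le_downloadCost h))
  have h0 := C.sum_iSup_le_rpow hρ 0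
  have h1 := C.sum_iSup_le_rpow hρ 1
  refine mul_le_mul_of_nonneg_left (max_le_max le_rfl ?_)
    (mul_nonneg (by positivity) (Real.logb_nonneg one_lt_two
      (by exact_mod_cast h.1.trans' one_le_two)))
  rw [Fin.sum_univ_two]
  linarith

/-- The server without leakage has sum 1 and the other at most `2 ^ ρ`, so the general bound becomes
`5/2 - (1 + 2 ^ ρ) / 2`. -/
lemma rate_le_of_maxLAt_eq_zero (h : C.IsIR) {ρ : ℝ} (h1 : ρ ≤ 1) (hρ : C.maxL ≤ ρ)
    {l : Fin 2} (hl : C.maxLAt l = 0) :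
    C.rate ≤ (2 - (2 : ℝ) ^ (ρ - 1))⁻¹ := by
  have hp : (2 : ℝ) ^ (ρ - 1) ≤ 1 := Real.rpow_le_one_of_one_le_of_nonpos one_le_two (by linarith)
  have hp2 : (2 : ℝ) ^ ρ = 2 * 2 ^ (ρ - 1) := by
    rw [Real.rpow_sub_one two_ne_zero]; ring
  refine rate_le h (by linarith) (le_trans ?_ (le_downloadCost h))
  refine mul_le_mul_of_nonneg_left (le_max_of_le_right ?_)
    (mul_nonneg (by positivity) (Real.logb_nonneg one_lt_two
      (by exact_mod_cast h.1.trans' one_le_two)))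
  have e := C.sum_iSup_eq_one hl
  have h0 := C.sum_iSup_le_rpow hρ 0
  have h1 := C.sum_iSup_le_rpow hρ 1
  rw [Fin.sum_univ_two]
  fin_cases l <;> simp only [Fin.zero_eta, Fin.mk_one] at e <;> linarith

end Scheme

/-! ### Time sharing -/

namespace Scheme

variable {M n : ℕ} [NeZero n] (C : Scheme M n)

/-- Only the shift `l' - l` gives server `l` the role `l'`, and it is independent of the strategy.
-/
lemma queryProb_timeShare (l : Fin n) (m : Fin M) (l' : Fin n) (q : C.Query l') :
    C.timeShare.queryProb l m ⟨l', q⟩ = (n : ℝ)⁻¹ * C.queryProb l' m q := by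
  have h : {ts : Fin n × C.Strategy |
      (⟨l + ts.1, C.encode (l + ts.1) m ts.2⟩ : Σ l, C.Query l) = ⟨l', q⟩} =
      {l' - l} ×ˢ {s | C.encode l' m s = q} := by
    ext ⟨t, s⟩
    simp only [Set.mem_ofPred_eq, Set.mem_prod, Set.mem_singleton_iff, eq_sub_iff_add_eq']
    constructor
    · intro h
      rw [Sigma.mk.injEq] at h
      obtain ⟨h1, h2⟩ := h
      subst h1
      exact ⟨rfl, eq_of_heq h2⟩
    · rintro ⟨rfl, rfl⟩
      rfl
  change ((PMF.uniformOfFintype (Fin n)).toMeasure.prod C.strategyLaw).real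
    {ts : Fin n × C.Strategy |
      (⟨l + ts.1, C.encode (l + ts.1) m ts.2⟩ : Σ l, C.Query l) = ⟨l', q⟩} = _
  rw [h, measureReal_prod_prod]
  congr 1
  rw [measureReal_def, PMF.toMeasure_apply_singleton _ _ (MeasurableSet.singleton _)]
  simp

/-- The query reveals the role, so the maximum over the index is taken within each role and the
leakage sums are averaged over roles. -/
lemma sum_iSup_timeShare (l : Fin n) :
    ∑ q, ⨆ m, C.timeShare.queryProb l m q =
      (n : ℝ)⁻¹ * ∑ l', ∑ q, ⨆ m, C.queryProb l' m q := by
  change ∑ q : (Σ l, C.Query l), ⨆ m, C.timeShare.queryProb l m q = _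
  rw [Fintype.sum_sigma]
  simp_rw [queryProb_timeShare, ← Real.mul_iSup_of_nonneg (inv_nonneg.2 (Nat.cast_nonneg n)),
    ← Finset.mul_sum]

lemma downloadCost_timeShare : C.timeShare.downloadCost = C.downloadCost := by
  have h : ∀ l m, ∑ q, C.timeShare.queryProb l m q * (C.timeShare.ansLen l q : ℝ) =
      (n : ℝ)⁻¹ * ∑ l', ∑ q, C.queryProb l' m q * (C.ansLen l' q : ℝ) := fun l m => by
    change ∑ q : (Σ l, C.Query l), C.timeShare.queryProb l m q * (C.ansLen q.1 q.2 : ℝ) = _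
    rw [Fintype.sum_sigma]
    simp_rw [queryProb_timeShare, mul_assoc, ← Finset.mul_sum]
  have hn : (n : ℝ) ≠ 0 := Nat.cast_ne_zero.2 (NeZero.ne n)
  rw [downloadCost, downloadCost]
  simp_rw [h, Finset.sum_const, Finset.card_univ, Fintype.card_fin, nsmul_eq_mul,
    mul_inv_cancel_left₀ hn]
  rfl

lemma rate_timeShare : C.timeShare.rate = C.rate := by
  rw [rate, rate, downloadCost_timeShare]
  rfl

end Scheme

/-! ### Scheme A for two files and two servers -/

section SchemeA

variable (p : I)

/-- The two-server Scheme A for two files. -/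
noncomputable abbrev binaryA : Scheme 2 2 := schemeA 1 2 (bernoulliStrategy 1 p)

/-- The two entries of the query to server `l`, for requested file `m` and strategy `a`. -/
lemma encode_binaryA (l m a : Fin 2) :
    ((binaryA p).encode l m fun _ => a).1 = if m = 0 then ![l - a, a] else ![a, l - a] := by
  change (m.insertNth (l - ∑ _j : Fin 1, a) (fun _ => a) : Fin 2 → Fin 2) = _
  revert l m a
  decide

lemma strategy_eq_const (s : Fin 1 → Fin 2) : ∃ a, s = fun _ => a :=
  ⟨s 0, funext fun i => by rw [Subsingleton.elim i 0]⟩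

/-- The empty answer to the zero query loses nothing, since the sum it replaces is always 0. -/
lemma sum_symbolAt_eq (l : Fin 2) (q : (binaryA p).Query l) (x x' : (binaryA p).Files)
    (h : (binaryA p).answer l q x = (binaryA p).answer l q x') :
    symbolAt (n := 2) (x 0) (q.1 0) + symbolAt (n := 2) (x 1) (q.1 1) =
      symbolAt (n := 2) (x' 0) (q.1 0) + symbolAt (n := 2) (x' 1) (q.1 1) := by
  by_cases hq : q.1 = 0
  · simp [hq, symbolAt]
  · have hlen : 0 < (binaryA p).ansLen l q := by
      change 0 < if q.1 = 0 then 0 else 1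
      simp [hq]
    have h1 : ∑ i : Fin 2, symbolAt (n := 2) (x i) (q.1 i) =
      ∑ i : Fin 2, symbolAt (n := 2) (x' i) (q.1 i) := congrFun h ⟨0, hlen⟩
    simpa [Fin.sum_univ_two] using h1

/-- The two queries agree except at position `m`, where one has 0 and the other 1; the answers, the
empty one read as 0, differ by the requested bit. -/
lemma binaryA_answers_determine (m : Fin 2) (s : Fin 1 → Fin 2) (x x' : (binaryA p).Files)
    (h : ∀ l, (binaryA p).answer l ((binaryA p).encode l m s) x =
      (binaryA p).answer l ((binaryA p).encode l m s) x') : x m = x' m := by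
  obtain ⟨a, rfl⟩ := strategy_eq_const s
  have h0 := sum_symbolAt_eq p 0 _ x x' (h 0)
  have h1 := sum_symbolAt_eq p 1 _ x x' (h 1)
  rw [encode_binaryA] at h0 h1
  refine funext fun i => ?_
  obtain rfl : i = (0 : Fin 1) := Subsingleton.elim (α := Fin 1) _ _
  fin_cases m <;> fin_cases a <;> simp [symbolAt] at h0 h1 ⊢ <;> grind

/-- The query to server `l` whose second entry is `a`. -/
def binaryQuery (l a : Fin 2) : {q : Fin 2 → Fin 2 // ∑ i, q i = l} :=
  ⟨![l - a, a], by simp⟩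

/-- Queries to a server correspond to their second entry. -/
def binaryQueryEquiv (l : Fin 2) : Fin 2 ≃ {q : Fin 2 → Fin 2 // ∑ i, q i = l} where
  toFun := binaryQuery l
  invFun q := q.1 1
  left_inv a := by simp [binaryQuery]
  right_inv q := by
    refine Subtype.ext (funext (Fin.forall_fin_two.2 ⟨?_, rfl⟩))
    have := q.2
    rw [Fin.sum_univ_two] at this
    simp [binaryQuery, ← this]

lemma sum_binaryQuery (l : Fin 2) (f : (binaryA p).Query l → ℝ) :
    ∑ q, f q = f (binaryQuery l 0) + f (binaryQuery l 1) := by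
  rw [← Fin.sum_univ_two (f := fun a => f (binaryQuery l a))]
  exact ((binaryQueryEquiv l).sum_comp f).symm

lemma bernoulliStrategy_real_singleton (a : Fin 2) :
    (bernoulliStrategy 1 p).real {fun _ => a} = if a = 1 then (p : ℝ) else 1 - p := by
  rw [measureReal_def, Measure.pi_singleton, Fin.prod_univ_one, ← measureReal_def,
    bernoulliMeasure_real_apply _ (MeasurableSet.singleton _)]
  fin_cases a <;> simp

lemma queryProb_binaryA_zero (l a : Fin 2) :
    (binaryA p).queryProb l 0 (binaryQuery l a) = if a = 1 then (p : ℝ) else 1 - p := by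
  rw [← bernoulliStrategy_real_singleton]
  refine congrArg _ (Set.ext fun s => ?_)
  obtain ⟨b, rfl⟩ := strategy_eq_const s
  refine Subtype.ext_iff.trans ?_
  rw [encode_binaryA]
  change _ = ![l - a, a] ↔ (fun _ : Fin 1 => b) = fun _ => a
  revert l a b
  decide

/-- When the second file is requested the first entry `l - a` is the strategy, and it is 0 exactly
when `a = l`. -/
lemma queryProb_binaryA_one (l a : Fin 2) :
    (binaryA p).queryProb l 1 (binaryQuery l a) = if a = l then 1 - (p : ℝ) else p := by
  have hla : l - a = 1 ↔ a ≠ l := by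
    revert l a
    decide
  rw [← ite_not, ← if_congr hla rfl rfl,
    ← bernoulliStrategy_real_singleton p (l - a)]
  clear hla
  refine congrArg _ (Set.ext fun s => ?_)
  obtain ⟨b, rfl⟩ := strategy_eq_const s
  refine Subtype.ext_iff.trans ?_
  rw [encode_binaryA]
  change _ = ![l - a, a] ↔ (fun _ : Fin 1 => b) = fun _ => l - a
  revert l a b
  decide

lemma ansLen_binaryA (l a : Fin 2) :
    (binaryA p).ansLen l (binaryQuery l a) = if l = 0 ∧ a = 0 then 0 else 1 := by
  change (if (![l - a, a] : Fin 2 → Fin 2) = 0 then 0 else 1) = _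
  revert l a
  decide

lemma card_binaryA_query (l : Fin 2) : Fintype.card ((binaryA p).Query l) = 2 :=
  (Fintype.card_congr (binaryQueryEquiv l)).symm.trans (Fintype.card_fin 2)

lemma card_binaryA_Sym : Fintype.card (binaryA p).Sym = 2 := rfl

lemma card_binaryA_Down : Fintype.card (binaryA p).Down = 2 := rfl

lemma iSup_fin_two (f : Fin 2 → ℝ) : ⨆ i, f i = max (f 0) (f 1) := by
  refine le_antisymm (ciSup_le (Fin.forall_fin_two.2 ⟨le_max_left _ _, le_max_right _ _⟩)) ?_
  exact max_le (le_ciSup (Set.finite_range f).bddAbove 0) (le_ciSup (Set.finite_range f).bddAbove 1)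

/-- Server 0 receives `(0, 0)` or `(1, 1)`, with both entries equal to the strategy, whichever file
is requested. -/
lemma sum_iSup_binaryA_zero : ∑ q, ⨆ m, (binaryA p).queryProb 0 m q = 1 := by
  simp [sum_binaryQuery, iSup_fin_two, queryProb_binaryA_zero, queryProb_binaryA_one]

/-- Server 1 receives `(1, 0)` or `(0, 1)`, and changing the requested file swaps their
probabilities `p` and `1 - p`. -/
lemma sum_iSup_binaryA_one :
    ∑ q, ⨆ m, (binaryA p).queryProb 1 m q = 2 * max (p : ℝ) (1 - p) := by
  simp [sum_binaryQuery, iSup_fin_two, queryProb_binaryA_zero, queryProb_binaryA_one]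
  rw [max_comm]; ring

/-- Server 1 always sends one bit; server 0 sends one unless its query is zero, which has
probability `1 - p`. -/
lemma downloadCost_binaryA : (binaryA p).downloadCost = 1 + p := by
  rw [Scheme.downloadCost, card_binaryA_Down]
  simp [sum_binaryQuery, queryProb_binaryA_zero, queryProb_binaryA_one, ansLen_binaryA]
  ring

lemma rate_binaryA : (binaryA p).rate = (1 + (p : ℝ))⁻¹ := by
  rw [Scheme.rate, downloadCost_binaryA, card_binaryA_Sym]
  change ((1 : ℕ) : ℝ) * _ / _ = _
  simp

lemma binaryA_isIR : (binaryA p).IsIR :=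
  ⟨le_rfl, Nat.one_pos, .of_encode _ (binaryA_answers_determine p)⟩

lemma timeShare_binaryA_isIR : (binaryA p).timeShare.IsIR := by
  refine ⟨le_rfl, Nat.one_pos, .of_encode _ fun m ⟨t, s⟩ x x' h => ?_⟩
  refine binaryA_answers_determine p m s x x' fun l => ?_
  -- Under the shift `t`, the server playing role `l` is `l - t`.
  have h1 := h (l - t)
  have h2 : l = l - t + t := (sub_add_cancel l t).symm
  rw [h2]
  exact h1

lemma two_pow_ansLen_le (l : Fin 2) (q : (binaryA p).Query l) :
    2 ^ (binaryA p).ansLen l q ≤ 2 ^ 1 := by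
  refine Nat.pow_le_pow_right two_pos ?_
  change (if q.1 = 0 then 0 else 1) ≤ 1
  split_ifs <;> simp

lemma binaryA_restricted {α : ℕ} (hα : 2 ≤ α) : (binaryA p).Restricted α := fun l =>
  ⟨(card_binaryA_query p l).trans_le hα, two_pow_ansLen_le p l⟩

lemma timeShare_binaryA_restricted {α : ℕ} (hα : 4 ≤ α) :
    (binaryA p).timeShare.Restricted α := fun l => by
  refine ⟨?_, fun q => two_pow_ansLen_le p q.1 q.2⟩
  refine le_trans (le_of_eq ?_) hα
  change Fintype.card (Σ l, (binaryA p).Query l) = 4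
  rw [Fintype.card_sigma, Fin.sum_univ_two, card_binaryA_query, card_binaryA_query]

lemma Scheme.maxL_le_of_sum_iSup_le {M n : ℕ} [NeZero M] [NeZero n] {C : Scheme M n} {ρ : ℝ}
    (h : ∀ l, ∑ q, ⨆ m, C.queryProb l m q ≤ (2 : ℝ) ^ ρ) : C.maxL ≤ ρ :=
  ciSup_le fun l =>
    (Real.logb_le_iff_le_rpow one_lt_two (zero_lt_one.trans_le (C.one_le_sum_iSup l))).2 (h l)

end SchemeA

end WPIR

theorem mainTheorem3 (ρ : ℝ) (h0 : 0 ≤ ρ) (h1 : ρ ≤ 1) :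
    (∀ α : ℕ, 4 ≤ α →
      IsGreatest {R : ℝ | ∃ C : WPIR.Scheme 2 2, C.Admissible α ρ ∧ C.rate = R}
        (max 1 (5 / 2 - (2 : ℝ) ^ ρ))⁻¹ ∧
      ∃ p : unitInterval, (p : ℝ) = max 0 (3 / 2 - (2 : ℝ) ^ ρ) ∧
        (WPIR.schemeA 1 2 (WPIR.bernoulliStrategy 1 p)).timeShare.Admissible α ρ ∧
        (WPIR.schemeA 1 2 (WPIR.bernoulliStrategy 1 p)).timeShare.rate =
          (max 1 (5 / 2 - (2 : ℝ) ^ ρ))⁻¹) ∧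
    (∀ α : ℕ, 2 ≤ α →
      IsGreatest {R : ℝ | ∃ C : WPIR.Scheme 2 2, C.Admissible α ρ ∧
          (∃ l, C.maxLAt l = 0) ∧ C.rate = R}
        (2 - (2 : ℝ) ^ (ρ - 1))⁻¹ ∧
      ∃ p : unitInterval, (p : ℝ) = 1 - (2 : ℝ) ^ (ρ - 1) ∧
        (WPIR.schemeA 1 2 (WPIR.bernoulliStrategy 1 p)).Admissible α ρ ∧
        (∃ l, (WPIR.schemeA 1 2 (WPIR.bernoulliStrategy 1 p)).maxLAt l = 0) ∧
        (WPIR.schemeA 1 2 (WPIR.bernoulliStrategy 1 p)).rate =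
          (2 - (2 : ℝ) ^ (ρ - 1))⁻¹) := by
  have hpow : (1 : ℝ) ≤ 2 ^ ρ := Real.one_le_rpow one_le_two h0
  have hpow2 : (2 : ℝ) ^ ρ ≤ 2 := by
    simpa using Real.rpow_le_rpow_of_exponent_le one_le_two h1
  have hhalf : (2 : ℝ) ^ (ρ - 1) = 2 ^ ρ / 2 := Real.rpow_sub_one two_ne_zero ρ
  constructor
  · intro α hα
    -- For `p ≤ 1/2` the time-shared leakage sum is `(1 + 2 (1 - p)) / 2 = 3/2 - p`; this is the
    -- least `p ≥ 0` that keeps it below `2 ^ ρ`.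
    let p : unitInterval := ⟨max 0 (3 / 2 - 2 ^ ρ), le_max_left _ _, max_le zero_le_one (by linarith)⟩
    have hp : (p : ℝ) = max 0 (3 / 2 - 2 ^ ρ) := rfl
    have hadm : (WPIR.binaryA p).timeShare.Admissible α ρ := by
      refine ⟨WPIR.timeShare_binaryA_isIR p, WPIR.timeShare_binaryA_restricted p hα,
        WPIR.Scheme.maxL_le_of_sum_iSup_le fun l => ?_⟩
      rw [WPIR.Scheme.sum_iSup_timeShare, Fin.sum_univ_two, WPIR.sum_iSup_binaryA_zero,
        WPIR.sum_iSup_binaryA_one]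
      have h2 : (p : ℝ) ≤ 1 / 2 := max_le (by norm_num) (by linarith)
      have h3 : 3 / 2 - 2 ^ ρ ≤ (p : ℝ) := le_max_right _ _
      rw [max_eq_right (by linarith)]
      push_cast
      linarith
    have hrate : (WPIR.binaryA p).timeShare.rate = (max 1 (5 / 2 - (2 : ℝ) ^ ρ))⁻¹ := by
      rw [WPIR.Scheme.rate_timeShare, WPIR.rate_binaryA, hp, ← max_add_add_left]
      congr 2 <;> ring
    refine ⟨⟨⟨_, hadm, hrate⟩, ?_⟩, p, hp, hadm, hrate⟩
    rintro _ ⟨C, hC, rfl⟩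
    exact WPIR.Scheme.rate_le_of_maxL_le hC.1 hC.2.2
  · intro α hα
    -- Chosen so that the leakage sum `2 (1 - p)` of server 1 equals `2 ^ ρ`; here `p ≤ 1/2` because
    -- `2 ^ ρ ≥ 1`.
    let p : unitInterval := ⟨1 - 2 ^ (ρ - 1), by linarith, by linarith⟩
    have hp : (p : ℝ) = 1 - 2 ^ (ρ - 1) := rfl
    have hadm : (WPIR.binaryA p).Admissible α ρ := by
      refine ⟨WPIR.binaryA_isIR p, WPIR.binaryA_restricted p hα,
        WPIR.Scheme.maxL_le_of_sum_iSup_le (Fin.forall_fin_two.2 ⟨?_, ?_⟩)⟩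
      · rw [WPIR.sum_iSup_binaryA_zero]
        exact hpow
      · rw [WPIR.sum_iSup_binaryA_one, max_eq_right (by linarith)]
        linarith
    have hzero : ∃ l, (WPIR.binaryA p).maxLAt l = 0 :=
      ⟨0, by rw [WPIR.Scheme.maxLAt, WPIR.sum_iSup_binaryA_zero, Real.logb_one]⟩
    have hrate : (WPIR.binaryA p).rate = (2 - (2 : ℝ) ^ (ρ - 1))⁻¹ := by
      rw [WPIR.rate_binaryA, hp]
      congr 1
      ring
    refine ⟨⟨⟨_, hadm, hzero, hrate⟩, ?_⟩, p, hp, hadm, hzero, hrate⟩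
    rintro _ ⟨C, hC, ⟨l, hl⟩, rfl⟩
    exact WPIR.Scheme.rate_le_of_maxLAt_eq_zero hC.1 h1 hC.2.2 hl
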